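/- Let $E$ be a $d$-dimensional Euclidean space (for instance $\mathbb{R}^d$, or the row space of a $d\times n$ generator matrix of rank $d$), with Lebesgue measure $\mathrm{vol}$. For vectors $G=(g_1,\dots,g_d)$ in $E$ let $\Lambda(G)=\{\sum_i k_i g_i : k_i\in\mathbb{Z}\}$ and let $\Omega(G)=\{x\in E : \|x\|\le\|x-\lambda\| \text{ for all } \lambda\in\Lambda(G)\}$ be the Voronoi cell of $\Lambda(G)$. Let $B$ be a basis of $E$, and let $A=(a_1,\dots,a_d)$ generate the dual lattice of $\Lambda(B)$ scaled by $2\pi$, that is, $\Lambda(A)=\{x\in E : \langle x,y\rangle\in 2\pi\mathbb{Z} \text{ for all } y\in\Lambda(B)\}$. Let $\omega_0>0$, $S_0\ge 0$, $\Delta=\{\omega\in E:\|\omega\|\le\omega_0\}$, and let $(X(t))_{t\in E}$ be a real or complex wide-sense stationary process (finite second moments, constant mean, autocorrelation depending only on the time difference) whose power spectral density is $S(\omega)=S_0$ for $\omega\in\Delta$ and $S(\omega)=0$ for $\omega\notin\Delta$, that is, $$\mathbb{E}\bigl[X(t+\tau)\overline{X(t)}\bigr]=\frac{1}{(2\pi)^d}\int_E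 S(\omega)\,e^{i\langle\omega,\tau\rangle}\,d\omega\qquad\text{for all } t,\tau\in E .$$ Put $\sigma^2=(2\pi)^{-d}\int_E S(\omega)\,d\omega$. For $t\in E$ let $\hat X(t)$ be the best linear interpolator of $X(t)$ from the samples on $\Lambda(B)$, i.e. the orthogonal projection in $L^2$ of $X(t)$ onto the closed linear span of $\{X(\lambda):\lambda\in\Lambda(B)\}$. Then $t\mapsto\mathbb{E}|X(t)-\hat X(t)|^2$ is integrable on $\Omega(B)$, and the average reconstruction error variance is $$\sigma_{\mathrm e}^2:=\frac{1}{\mathrm{vol}\,\Omega(B)}\int_{\Omega(B)}\mathbb{E}\bigl|X(t)-\hat X(t)\bigr|^2\,dt=\sigma^2\,\frac{\mathrm{vol}(\Delta\setminus\Omega(A))}{\mathrm{vol}\,\Delta}.$$ -/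

import Mathlib

open MeasureTheory
open scoped InnerProductSpace

noncomputable section

namespace LatticeSampling

section Lattices

variable {E : Type*} [NormedAddCommGroup E] [InnerProductSpace ℝ E]

/-- The lattice `Λ(G)`: all integer combinations of the generators `G 0, …, G (d - 1)`
(the rows of a generator matrix). -/
def lattice {d : ℕ} (G : Fin d → E) : Submodule ℤ E :=
  Submodule.span ℤ (Set.range G)

/-- The dual lattice scaled by `2π`: all `x` whose inner product with every lattice vector
is an integer multiple of `2π`. -/
def scaledDual (L : Submodule ℤ E) : Set E :=
  {x | ∀ y ∈ L, ∃ k : ℤ, ⟪x, y⟫_ℝ = 2 * Real.pi * k}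

/-- The (closed) Voronoi cell of the origin: all points that are at least as close to `0`
as to any other lattice point. -/
def voronoiCell (L : Submodule ℤ E) : Set E :=
  {x | ∀ y ∈ L, ‖x‖ ≤ ‖x - y‖}

end Lattices

section Processes

variable {E : Type*} [NormedAddCommGroup E] [InnerProductSpace ℝ E]
variable {Ω : Type*} [MeasurableSpace Ω]
variable {𝕜 : Type*} [RCLike 𝕜]

/-- The autocorrelation `𝔼[X(s) conj X(t)]`. -/
def autocorr (P : Measure Ω) (X : E → Ω → 𝕜) (s t : E) : 𝕜 :=
  ∫ w, X s w * starRingEnd 𝕜 (X t w) ∂P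

/-- A (wide-sense) stationary process: finite second moments, constant mean, and
autocorrelation that depends on the time difference only. -/
structure IsStationary (P : Measure Ω) (X : E → Ω → 𝕜) : Prop where
  memLp : ∀ t, MemLp (X t) 2 P
  mean_eq : ∀ s t, ∫ w, X s w ∂P = ∫ w, X t w ∂P
  autocorr_eq : ∀ τ t, autocorr P X (t + τ) t = autocorr P X τ 0

/-- `S` is the power spectral density of the process `X` on a `d`-dimensional space, as a
function of the angular frequency: `S` is nonnegative and integrable, and the autocorrelation at
lag `τ` is `(2π)⁻ᵈ ∫ S(ω) exp(i⟨ω, τ⟩) dω`. Both sides are compared in `ℂ`, so that real and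
complex processes are covered. -/
structure HasSpectralDensity [FiniteDimensional ℝ E] [MeasurableSpace E] [BorelSpace E]
    (P : Measure Ω) (X : E → Ω → 𝕜) (S : E → ℝ) : Prop where
  nonneg : ∀ ω, 0 ≤ S ω
  integrable : Integrable S
  autocorr_eq : ∀ τ t, RCLike.map 𝕜 ℂ (autocorr P X (t + τ) t) =
    ((2 * (Real.pi : ℂ)) ^ Module.finrank ℝ E)⁻¹ *
      ∫ ω, (S ω : ℂ) * Complex.exp (Complex.I * (⟪ω, τ⟫_ℝ : ℂ))

/-- The process variance `σ² = (2π)⁻ᵈ ∫ S(ω) dω`. -/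
def processVariance [FiniteDimensional ℝ E] [MeasurableSpace E] [BorelSpace E]
    (S : E → ℝ) : ℝ :=
  ((2 * Real.pi) ^ Module.finrank ℝ E)⁻¹ * ∫ ω, S ω

/-- The closed linear span, in `L²(P)`, of the samples `X(λ)`, `λ ∈ L`: the space of all
linear interpolators. -/
def sampleSpan {P : Measure Ω} {X : E → Ω → 𝕜} (hX : IsStationary P X) (L : Submodule ℤ E) :
    Submodule 𝕜 (Lp 𝕜 2 P) :=
  (Submodule.span 𝕜 ((fun t => (hX.memLp t).toLp (X t)) '' (L : Set E))).topologicalClosure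

/-- The best linear interpolator of `X(t)` from the samples `X(λ)`, `λ ∈ L`: the element of
their closed linear span that is nearest to `X(t)` in mean square, i.e. the orthogonal
projection of `X(t)`. -/
def bestLinearInterpolator {P : Measure Ω} {X : E → Ω → 𝕜} (hX : IsStationary P X)
    (L : Submodule ℤ E) (t : E) : Lp 𝕜 2 P :=
  haveI : CompleteSpace (sampleSpan hX L) :=
    (Submodule.isClosed_topologicalClosure _).completeSpace_coe
  (sampleSpan hX L).starProjection ((hX.memLp t).toLp (X t))

/-- The reconstruction error variance at time `t`: the mean-square difference between `X(t)`
and its best linear interpolator. -/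
def errorVarianceAt {P : Measure Ω} {X : E → Ω → 𝕜} (hX : IsStationary P X)
    (L : Submodule ℤ E) (t : E) : ℝ :=
  ∫ w, ‖X t w - bestLinearInterpolator hX L t w‖ ^ 2 ∂P

/-- The average reconstruction error variance: the mean of the (lattice-periodic) error
variance over the Voronoi cell of the sampling lattice. -/
def averageErrorVariance [FiniteDimensional ℝ E] [MeasurableSpace E] [BorelSpace E]
    {P : Measure Ω} {X : E → Ω → 𝕜} (hX : IsStationary P X) (L : Submodule ℤ E) : ℝ :=
  ⨍ t in voronoiCell L, errorVarianceAt hX L t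

end Processes

/-- The isotropically bandlimited spectrum: `S₀` on the ball `Δ` of radius `ω₀` about `0`,
and `0` outside. -/
def flatSpectrum {E : Type*} [NormedAddCommGroup E] (S₀ ω₀ : ℝ) : E → ℝ :=
  (Metric.closedBall (0 : E) ω₀).indicator fun _ => S₀

end LatticeSampling

end

/-!
The Gram matrix of the process agrees with that of the characters `χ_t(ω) = exp(i⟨ω, t⟩)` in `L²`
of the spectral measure `(2π)⁻ᵈ S(ω) dω`, so the error variance at `t` is the squared distance of
`χ_t` to the closed span of `χ_λ`, `λ ∈ Λ(B)`. This span consists of all `Λ(A)`-periodic functions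
(density of trigonometric polynomials on the torus), and the projection onto it averages over the
orbits `ω + Λ(A)` with weights `S`. Hence the error at `t` is
`(2π)⁻ᵈ ∫ S(ω) (1 - ∑ₖ S(ω + k) χ_t(k) / Ŝ(ω)) dω`, where `Ŝ(ω) = ∑ₖ S(ω + k)` runs over
`k ∈ Λ(A)`. Averaging over `t ∈ Ω(B)` kills every term with `k ≠ 0` and leaves
`(2π)⁻ᵈ ∫ S (1 - S / Ŝ)`.

If `S = S₀` on `Δ` and `0` elsewhere, then `∫ S² / Ŝ = S₀ ∫ S / Ŝ` unfolds over `Ω(A)` to `S₀`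
times the volume of the points of `Ω(A)` whose orbit meets `Δ`. For a ball `Δ` these are exactly
the points of `Δ ∩ Ω(A)`, since a point of `Ω(A)` is a shortest element of its orbit.
-/

noncomputable section

namespace LatticeSampling

section Voronoi

variable {E : Type*} [NormedAddCommGroup E]

theorem isClosed_voronoiCell (L : Submodule ℤ E) : IsClosed (voronoiCell L) := by
  simp only [voronoiCell, Set.ofPred_forall]
  exact isClosed_biInter fun y _ => isClosed_le continuous_norm (by fun_prop)

theorem norm_le_norm_add_of_mem_voronoiCell {L : Submodule ℤ E} {k x : E} (hk : k ∈ L)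
    (hx : x ∈ voronoiCell L) : ‖x‖ ≤ ‖k + x‖ := by
  simpa only [sub_neg_eq_add, add_comm x k] using hx (-k) (neg_mem hk)

variable [InnerProductSpace ℝ E] [FiniteDimensional ℝ E] [MeasurableSpace E] [BorelSpace E]

theorem volume_setOf_norm_eq_norm_sub {v : E} (hv : v ≠ 0) :
    volume {x : E | ‖x‖ = ‖x - v‖} = 0 := by
  have h := Measure.addHaar_affineSubspace (volume : Measure E)
    (AffineSubspace.perpBisector (0 : E) v) (AffineSubspace.perpBisector_eq_top.not.2 hv.symm)
  convert h using 2
  ext x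
  simp [AffineSubspace.mem_perpBisector_iff_dist_eq, dist_eq_norm]

instance vaddInvariantMeasure_submodule (L : Submodule ℤ E) :
    VAddInvariantMeasure L E (volume : Measure E) :=
  inferInstanceAs (VAddInvariantMeasure L.toAddSubgroup E (volume : Measure E))

theorem isAddFundamentalDomain_voronoiCell (L : Submodule ℤ E) [DiscreteTopology L] :
    IsAddFundamentalDomain L (voronoiCell L) (volume : Measure E) := by
  refine IsAddFundamentalDomain.mk'' (isClosed_voronoiCell L).measurableSet.nullMeasurableSet
    (.of_forall fun x => ?_) (fun g hg => ?_)
    (fun g => (measurePreserving_vadd g volume).quasiMeasurePreserving)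
  · have hL : IsClosed (L : Set E) := L.toAddSubgroup.isClosed_of_discrete
    obtain ⟨y, hy, hxy⟩ := hL.exists_infDist_eq_dist ⟨0, zero_mem L⟩ x
    refine ⟨-⟨y, hy⟩, fun z hz => ?_⟩
    have hmin : ‖x - y‖ ≤ ‖x - (y + z)‖ := by
      simpa only [← dist_eq_norm, ← hxy] using Metric.infDist_le_dist_of_mem (add_mem hy hz)
    simpa [Submodule.vadd_def, neg_add_eq_sub, sub_sub] using hmin
  · refine measure_mono_null ?_ (volume_setOf_norm_eq_norm_sub (v := (g : E)) (by simpa using hg))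
    rintro _ ⟨⟨y, hy, rfl⟩, hx⟩
    refine le_antisymm (hx g g.2) ?_
    simpa [Submodule.vadd_def] using norm_le_norm_add_of_mem_voronoiCell g.2 hy

theorem volume_real_voronoiCell_pos (L : Submodule ℤ E) [DiscreteTopology L] [IsZLattice ℝ L] :
    0 < volume.real (voronoiCell L) := by
  rw [← ZLattice.covolume_eq_measure_fundamentalDomain L volume
    (isAddFundamentalDomain_voronoiCell L)]
  exact ZLattice.covolume_pos L volume

theorem volume_voronoiCell_ne_top (L : Submodule ℤ E) [DiscreteTopology L] [IsZLattice ℝ L] :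
    volume (voronoiCell L) ≠ ⊤ := fun h =>
  (volume_real_voronoiCell_pos L).ne' (by rw [measureReal_def, h, ENNReal.toReal_top])

end Voronoi

section Dual

variable {E : Type*} [NormedAddCommGroup E] [InnerProductSpace ℝ E] {d : ℕ}

instance discreteTopology_lattice (b : Module.Basis (Fin d) ℝ E) : DiscreteTopology (lattice b) :=
  inferInstanceAs (DiscreteTopology (Submodule.span ℤ (Set.range b)))

instance isZLattice_lattice (b : Module.Basis (Fin d) ℝ E) : IsZLattice ℝ (lattice b) :=
  inferInstanceAs (IsZLattice ℝ (Submodule.span ℤ (Set.range b)))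

theorem nondegenerate_inv_two_pi_smul_innerₗ :
    ((2 * Real.pi)⁻¹ • (innerₗ E : LinearMap.BilinForm ℝ E)).Nondegenerate :=
  ⟨fun x hx => by simpa [Real.pi_ne_zero] using hx x,
    fun x hx => by simpa [Real.pi_ne_zero] using hx x⟩

/-- The basis dual to `b` scaled by `2π`, that is, `⟪scaledDualBasis b i, b j⟫ = 2π δ i j`.
It generates the scaled dual of `lattice b`. -/
def scaledDualBasis (b : Module.Basis (Fin d) ℝ E) : Module.Basis (Fin d) ℝ E :=
  LinearMap.BilinForm.dualBasis _ nondegenerate_inv_two_pi_smul_innerₗ b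

theorem inner_eq_two_pi_mul_repr_scaledDualBasis (b : Module.Basis (Fin d) ℝ E) (x : E)
    (i : Fin d) : ⟪x, b i⟫_ℝ = 2 * Real.pi * (scaledDualBasis b).repr x i := by
  rw [scaledDualBasis, LinearMap.BilinForm.dualBasis_repr_apply]
  simp only [LinearMap.smul_apply, innerₗ_apply_apply, smul_eq_mul]
  field_simp

theorem scaledDual_lattice (b : Module.Basis (Fin d) ℝ E) :
    scaledDual (lattice b) = lattice (scaledDualBasis b) := by
  ext x
  rw [SetLike.mem_coe, lattice, lattice, Module.Basis.mem_span_iff_repr_mem]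
  constructor
  · intro h i
    obtain ⟨k, hk⟩ := h (b i) (Submodule.subset_span ⟨i, rfl⟩)
    rw [inner_eq_two_pi_mul_repr_scaledDualBasis] at hk
    exact ⟨k, by simpa [Real.pi_ne_zero] using hk.symm⟩
  · intro h y hy
    induction hy using Submodule.span_induction with
    | mem y hy =>
      obtain ⟨i, rfl⟩ := hy
      obtain ⟨k, hk⟩ := h i
      exact ⟨k, by rw [inner_eq_two_pi_mul_repr_scaledDualBasis, ← hk]; simp⟩
    | zero => exact ⟨0, by simp⟩
    | add y z _ _ hy hz =>
      obtain ⟨k, hk⟩ := hy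
      obtain ⟨l, hl⟩ := hz
      exact ⟨k + l, by rw [inner_add_right, hk, hl]; push_cast; ring⟩
    | smul m y _ hy =>
      obtain ⟨k, hk⟩ := hy
      exact ⟨m * k, by
        rw [← Int.cast_smul_eq_zsmul ℝ, real_inner_smul_right, hk]; push_cast; ring⟩

end Dual

section Character

variable {E : Type*} [NormedAddCommGroup E] [InnerProductSpace ℝ E]

/-- The complex exponential `ω ↦ exp (i⟨ω, t⟩)` on the frequency space, the spectral counterpart
of the process at time `t`. -/
def character (t ω : E) : ℂ := Complex.exp (Complex.I * (⟪ω, t⟫_ℝ : ℂ))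

theorem norm_character (t ω : E) : ‖character t ω‖ = 1 := by
  rw [character, mul_comm, Complex.norm_exp_ofReal_mul_I]

@[fun_prop]
theorem continuous_character {α : Type*} [TopologicalSpace α] {f g : α → E} (hf : Continuous f)
    (hg : Continuous g) : Continuous fun x => character (f x) (g x) := by
  unfold character; fun_prop

theorem character_zero_left (ω : E) : character 0 ω = 1 := by simp [character]

theorem character_zero_right (t : E) : character t 0 = 1 := by simp [character]

theorem character_add_left (s t ω : E) :
    character (s + t) ω = character s ω * character t ω := by
  simp only [character, inner_add_right, Complex.ofReal_add, mul_add, Complex.exp_add]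

theorem character_add_right (t ω ω' : E) :
    character t (ω + ω') = character t ω * character t ω' := by
  simp only [character, inner_add_left, Complex.ofReal_add, mul_add, Complex.exp_add]

theorem conj_character (t ω : E) : starRingEnd ℂ (character t ω) = character (-t) ω := by
  simp [character, ← Complex.exp_conj]

theorem conj_character_mul_character (s t ω : E) :
    starRingEnd ℂ (character s ω) * character t ω = character (t - s) ω := by
  rw [conj_character, ← character_add_left, neg_add_eq_sub]

theorem character_eq_one {L : Submodule ℤ E} {s k : E} (hs : s ∈ L) (hk : k ∈ scaledDual L) :
    character s k = 1 := by
  obtain ⟨m, hm⟩ := hk s hs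
  rw [character, hm, Complex.exp_eq_one_iff]
  exact ⟨m, by push_cast; ring⟩

variable [MeasurableSpace E] [BorelSpace E]

theorem memLp_character (μ : Measure E) [IsFiniteMeasure μ] [SecondCountableTopology E] (t : E) :
    MemLp (character t) 2 μ :=
  .of_bound (by fun_prop) 1 (.of_forall fun ω => (norm_character t ω).le)

/-- The class of a character in `L²(μ)`. -/
def characterLp (μ : Measure E) [IsFiniteMeasure μ] [SecondCountableTopology E] (t : E) :
    Lp ℂ 2 μ :=
  (memLp_character μ t).toLp (character t)

theorem inner_characterLp_toLp (μ : Measure E) [IsFiniteMeasure μ] [SecondCountableTopology E]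
    (s : E) {f : E → ℂ} (hf : MemLp f 2 μ) :
    ⟪characterLp μ s, hf.toLp f⟫_ℂ = ∫ ω, starRingEnd ℂ (character s ω) * f ω ∂μ := by
  rw [L2.inner_def]
  refine integral_congr_ae ?_
  filter_upwards [(memLp_character μ s).coeFn_toLp, hf.coeFn_toLp] with ω hs hf
  rw [characterLp, hs, hf, RCLike.inner_apply, mul_comm]

theorem inner_characterLp (μ : Measure E) [IsFiniteMeasure μ] [SecondCountableTopology E]
    (s t : E) : ⟪characterLp μ s, characterLp μ t⟫_ℂ = ∫ ω, character (t - s) ω ∂μ := by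
  rw [characterLp, characterLp]
  simp only [← conj_character_mul_character]
  exact inner_characterLp_toLp μ s (memLp_character μ t)

theorem setIntegral_add_left_of_periodic [FiniteDimensional ℝ E] {F : Type*}
    [NormedAddCommGroup F] [NormedSpace ℝ F] {L : Submodule ℤ E} [Countable L] {V : Set E}
    (hV : IsAddFundamentalDomain L V (volume : Measure E)) {f : E → F}
    (hf : ∀ (k : L) x, f (k +ᵥ x) = f x) (v : E) : ∫ x in V, f (v + x) = ∫ x in V, f x := by
  have himage := (measurePreserving_add_left (volume : Measure E) v).setIntegral_image_emb
    (MeasurableEquiv.addLeft v).measurableEmbedding f V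
  rw [← himage]
  exact (hV.vadd_of_comm v).setIntegral_eq hV hf

/-- Translating by `v = (π / ‖k‖²) k` multiplies `t ↦ character t k` by `-1`. -/
theorem setIntegral_character_eq_zero [FiniteDimensional ℝ E] {L : Submodule ℤ E} [Countable L]
    {V : Set E} (hV : IsAddFundamentalDomain L V (volume : Measure E)) {k : E}
    (hk : k ∈ scaledDual L) (hk₀ : k ≠ 0) : ∫ t in V, character t k = 0 := by
  set v : E := (Real.pi / ‖k‖ ^ 2) • k
  have hv : character v k = -1 := by
    rw [character, real_inner_smul_right, real_inner_self_eq_norm_sq,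
      div_mul_cancel₀ _ (by simpa using hk₀), mul_comm, Complex.exp_pi_mul_I]
  have hshift := setIntegral_add_left_of_periodic hV (f := fun t => character t k)
    (fun s t => by
      rw [Submodule.vadd_def, vadd_eq_add, character_add_left, character_eq_one s.2 hk, one_mul]) v
  simp only [character_add_left, hv, neg_one_mul, integral_neg] at hshift
  exact self_eq_neg.1 hshift.symm

end Character

section OrbitSum

variable {G α M : Type*} [AddGroup G] [AddAction G α]

variable (G) in
/-- The sum of the values of `f` along the orbit of `x`; it is `0` where the series diverges. For
a lattice acting by translations this is the periodization of `f`. -/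
def orbitSum [AddCommMonoid M] [TopologicalSpace M] (f : α → M) (x : α) : M :=
  ∑' g : G, f (g +ᵥ x)

theorem orbitSum_vadd [AddCommMonoid M] [TopologicalSpace M] (f : α → M) (g : G) (x : α) :
    orbitSum G f (g +ᵥ x) = orbitSum G f x := by
  simp only [orbitSum, vadd_vadd]
  exact (Equiv.addRight g).tsum_eq fun h => f (h +ᵥ x)

theorem orbitSum_mul_of_invariant [DivisionRing M] [TopologicalSpace M] [IsTopologicalRing M]
    [T2Space M] (f : α → M) {h : α → M} (hh : ∀ (g : G) x, h (g +ᵥ x) = h x) (x : α) :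
    orbitSum G (fun y => f y * h y) x = orbitSum G f x * h x := by
  simp only [orbitSum, hh, tsum_mul_right]

variable {F : Type*} [NormedAddCommGroup F] [Countable G]

theorem stronglyMeasurable_orbitSum [CompleteSpace F] {β : Type*} [MeasurableSpace α]
    [MeasurableConstVAdd G α] [MeasurableSpace β] {f : β → α → F}
    (hf : StronglyMeasurable fun p : β × α => f p.1 p.2) {u : β → α} (hu : Measurable u) :
    StronglyMeasurable fun b => orbitSum G (f b) (u b) :=
  .tsum fun g => hf.comp_measurable (measurable_id.prodMk (hu.const_vadd g))

variable [MeasurableSpace α] {μ : Measure α} [MeasurableConstVAdd G α] [VAddInvariantMeasure G α μ]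
  {V : Set α}

theorem tsum_lintegral_enorm_vadd_ne_top (hV : IsAddFundamentalDomain G V μ) {f : α → F}
    (hf : Integrable f μ) : ∑' g : G, ∫⁻ x in V, ‖f (g +ᵥ x)‖ₑ ∂μ ≠ ⊤ := by
  rw [← hV.lintegral_eq_tsum'' fun x => ‖f x‖ₑ]
  exact hf.hasFiniteIntegral.ne

theorem ae_summable_norm_vadd (hV : IsAddFundamentalDomain G V μ) {f : α → F}
    (hf : Integrable f μ) : ∀ᵐ x ∂μ.restrict V, Summable fun g : G => ‖f (g +ᵥ x)‖ := by
  refine summable_norm_of_tsum_eLpNorm_ne_top le_rfl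
    (fun g => (hf.1.comp_measurePreserving (measurePreserving_vadd g μ)).restrict) ?_
  simpa only [eLpNorm_one_eq_lintegral_enorm] using tsum_lintegral_enorm_vadd_ne_top hV hf

theorem setIntegral_orbitSum [NormedSpace ℝ F] (hV : IsAddFundamentalDomain G V μ) {f : α → F}
    (hf : Integrable f μ) : ∫ x in V, orbitSum G f x ∂μ = ∫ x, f x ∂μ := by
  rw [hV.integral_eq_tsum'' f hf]
  exact integral_tsum (fun g => (hf.1.comp_measurePreserving (measurePreserving_vadd g μ)).restrict)
    (tsum_lintegral_enorm_vadd_ne_top hV hf)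

end OrbitSum

section OrbitAverage

variable {G α : Type*} [AddGroup G] [AddAction G α]

variable (G) in
/-- The average of `f` along the orbit of `x` with weights `ρ`, that is, the conditional
expectation of `f` given the orbit when points are distributed with density `ρ`. It is `0` where
the weights of the orbit sum to `0` or are not summable. -/
def orbitAverage (ρ : α → ℝ) (f : α → ℂ) (x : α) : ℂ :=
  orbitSum G (fun y => ρ y * f y) x / orbitSum G ρ x

theorem orbitAverage_vadd (ρ : α → ℝ) (f : α → ℂ) (g : G) (x : α) :
    orbitAverage G ρ f (g +ᵥ x) = orbitAverage G ρ f x := by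
  simp only [orbitAverage, orbitSum_vadd]

theorem orbitAverage_mul_of_invariant (ρ : α → ℝ) (f : α → ℂ) {h : α → ℂ}
    (hh : ∀ (g : G) x, h (g +ᵥ x) = h x) (x : α) :
    orbitAverage G ρ (fun y => f y * h y) x = orbitAverage G ρ f x * h x := by
  simp only [orbitAverage, ← mul_assoc, orbitSum_mul_of_invariant _ hh, mul_div_right_comm]

theorem norm_orbitAverage_le {ρ : α → ℝ} (hρ : ∀ x, 0 ≤ ρ x) {f : α → ℂ} {C : ℝ}
    (hf : ∀ x, ‖f x‖ ≤ C) (x : α) : ‖orbitAverage G ρ f x‖ ≤ C := by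
  have hC : 0 ≤ C := (norm_nonneg _).trans (hf x)
  have hρ_sum : 0 ≤ orbitSum G ρ x := tsum_nonneg fun g => hρ _
  by_cases hs : Summable fun g : G => ρ (g +ᵥ x)
  · rw [orbitAverage, norm_div, Complex.norm_of_nonneg hρ_sum]
    refine div_le_of_le_mul₀ hρ_sum hC ?_
    rw [mul_comm]
    refine tsum_of_norm_bounded (hs.hasSum.mul_right C) fun g => ?_
    rw [norm_mul, Complex.norm_of_nonneg (hρ _)]
    exact mul_le_mul_of_nonneg_left (hf _) (hρ _)
  · simpa [orbitAverage, orbitSum, tsum_eq_zero_of_not_summable hs] using hC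

theorem orbitSum_mul_orbitAverage {ρ : α → ℝ} (hρ : ∀ x, 0 ≤ ρ x) (f : α → ℂ) {x : α}
    (hs : Summable fun g : G => ρ (g +ᵥ x)) :
    orbitSum G ρ x * orbitAverage G ρ f x = orbitSum G (fun y => ρ y * f y) x := by
  by_cases h₀ : orbitSum G ρ x = 0
  · have hρ₀ : ∀ g : G, ρ (g +ᵥ x) = 0 :=
      congrFun ((hasSum_zero_iff_of_nonneg fun g => hρ _).1 (hs.hasSum_iff.2 h₀))
    simp [orbitSum, hρ₀]
  · exact mul_div_cancel₀ _ (by exact_mod_cast h₀)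

variable [Countable G] [MeasurableSpace α] [MeasurableConstVAdd G α]

theorem measurable_orbitAverage {β : Type*} [MeasurableSpace β] {ρ : α → ℝ} (hρ : Measurable ρ)
    {f : β → α → ℂ} (hf : Measurable fun p : β × α => f p.1 p.2) {u : β → α} (hu : Measurable u) :
    Measurable fun b => orbitAverage G ρ (f b) (u b) := by
  have hnum : StronglyMeasurable fun b => orbitSum G (fun y => (ρ y : ℂ) * f b y) (u b) :=
    stronglyMeasurable_orbitSum
      ((Complex.measurable_ofReal.comp (hρ.comp measurable_snd)).mul hf).stronglyMeasurable hu
  have hden : StronglyMeasurable fun b => orbitSum G ρ (u b) :=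
    stronglyMeasurable_orbitSum (hρ.comp measurable_snd).stronglyMeasurable hu
  exact hnum.measurable.div (Complex.measurable_ofReal.comp hden.measurable)

theorem integral_mul_orbitAverage {μ : Measure α} [VAddInvariantMeasure G α μ] {V : Set α}
    (hV : IsAddFundamentalDomain G V μ) {ρ : α → ℝ} (hρ : ∀ x, 0 ≤ ρ x) (hρ_meas : Measurable ρ)
    (hρ_int : Integrable ρ μ) {f : α → ℂ} (hf : Measurable f) {C : ℝ} (hC : ∀ x, ‖f x‖ ≤ C) :
    ∫ x, ρ x * orbitAverage G ρ f x ∂μ = ∫ x, ρ x * f x ∂μ := by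
  have havg : Measurable (orbitAverage G ρ f) :=
    measurable_orbitAverage hρ_meas (hf.comp measurable_snd) measurable_id
  have hint {h : α → ℂ} (hh : Measurable h) (hhC : ∀ x, ‖h x‖ ≤ C) :
      Integrable (fun x => (ρ x : ℂ) * h x) μ :=
    hρ_int.ofReal.mul_bdd hh.aestronglyMeasurable (.of_forall hhC)
  rw [← setIntegral_orbitSum hV (hint hf hC), ←
    setIntegral_orbitSum hV (hint havg (norm_orbitAverage_le hρ hC))]
  refine integral_congr_ae ?_
  filter_upwards [ae_summable_norm_vadd hV hρ_int] with x hx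
  rw [orbitSum_mul_of_invariant _ (orbitAverage_vadd ρ f),
    ← orbitSum_mul_orbitAverage hρ f hx.of_norm]
  simp only [orbitSum, Complex.ofReal_tsum]

end OrbitAverage

section Density

open UnitAddTorus

theorem topologicalClosure_span_mFourier_toLp {ι : Type*} [Fintype ι]
    (ν : Measure (UnitAddTorus ι)) [IsFiniteMeasure ν] :
    (Submodule.span ℂ (Set.range fun n : ι → ℤ =>
      ContinuousMap.toLp 2 ν ℂ (mFourier n))).topologicalClosure = ⊤ := by
  simpa only [Submodule.map_span, ContinuousLinearMap.coe_coe, ← Set.range_comp,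
    Function.comp_def] using
    (ContinuousMap.toLp_denseRange ℂ ν ℂ (p := 2) (by simp)).topologicalClosure_map_submodule
      span_mFourier_closure_eq_top

variable {E : Type*} [NormedAddCommGroup E] [InnerProductSpace ℝ E] {d : ℕ}

/-- The coordinates of a point modulo the lattice generated by `a`. -/
def toTorus (a : Module.Basis (Fin d) ℝ E) (x : E) : UnitAddTorus (Fin d) :=
  fun i => (a.repr x i : UnitAddCircle)

/-- The representative in the fundamental parallelepiped of `a` of a point of the torus. -/
def ofTorus (a : Module.Basis (Fin d) ℝ E) (z : UnitAddTorus (Fin d)) : E :=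
  ∑ i, (AddCircle.equivIco 1 0 (z i) : ℝ) • a i

theorem ofTorus_toTorus (a : Module.Basis (Fin d) ℝ E) (x : E) :
    ofTorus a (toTorus a x) = ZSpan.fract a x := by
  refine a.ext_elem fun j => ?_
  simp [ofTorus, toTorus, ZSpan.repr_fract_apply, AddCircle.coe_equivIco_mk_apply,
    Finsupp.single_apply]

theorem measurable_ofTorus [MeasurableSpace E] [BorelSpace E] [SecondCountableTopology E]
    (a : Module.Basis (Fin d) ℝ E) : Measurable (ofTorus a) :=
  Finset.measurable_sum _ fun i _ => (measurable_subtype_coe.comp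
    ((AddCircle.measurableEquivIco 1 0).measurable.comp (measurable_pi_apply i))).smul_const _

theorem continuous_toTorus [FiniteDimensional ℝ E] (a : Module.Basis (Fin d) ℝ E) :
    Continuous (toTorus a) :=
  continuous_pi fun i =>
    (AddCircle.continuous_mk' 1).comp (a.coord i).continuous_of_finiteDimensional

theorem mFourier_toTorus (b : Module.Basis (Fin d) ℝ E) (n : Fin d → ℤ) (x : E) :
    mFourier n (toTorus (scaledDualBasis b) x) = character (∑ i, n i • b i) x := by
  simp only [mFourier, ContinuousMap.coe_mk, toTorus, fourier_coe_apply, ← Complex.exp_sum,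
    character, inner_sum, ← Int.cast_smul_eq_zsmul ℝ, real_inner_smul_right,
    inner_eq_two_pi_mul_repr_scaledDualBasis, Complex.ofReal_sum, Finset.mul_sum]
  congr! 2 with i
  push_cast
  ring

variable [FiniteDimensional ℝ E] [MeasurableSpace E] [BorelSpace E]

theorem compMeasurePreserving_mFourier (b : Module.Basis (Fin d) ℝ E) (μ : Measure E)
    [IsFiniteMeasure μ] {ν : Measure (UnitAddTorus (Fin d))} [IsFiniteMeasure ν]
    (hν : MeasurePreserving (toTorus (scaledDualBasis b)) μ ν) (n : Fin d → ℤ) :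
    Lp.compMeasurePreserving _ hν (ContinuousMap.toLp 2 ν ℂ (mFourier n)) =
      characterLp μ (∑ i, n i • b i) := by
  refine Lp.ext ((Lp.coeFn_compMeasurePreserving _ hν).trans (.trans ?_
    (memLp_character μ _).coeFn_toLp.symm))
  filter_upwards [hν.quasiMeasurePreserving.ae
    (ContinuousMap.coeFn_toLp (p := 2) ν (𝕜 := ℂ) (mFourier n))] with x hx
  rw [Function.comp_apply, hx, mFourier_toTorus]

theorem compMeasurePreserving_mem_closure_span_characterLp (b : Module.Basis (Fin d) ℝ E)
    (μ : Measure E) [IsFiniteMeasure μ] {ν : Measure (UnitAddTorus (Fin d))} [IsFiniteMeasure ν]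
    (hν : MeasurePreserving (toTorus (scaledDualBasis b)) μ ν) (g : Lp ℂ 2 ν) :
    Lp.compMeasurePreserving _ hν g ∈ (Submodule.span ℂ
      (characterLp μ '' (lattice b : Set E))).topologicalClosure := by
  set K := Submodule.span ℂ (characterLp μ '' (lattice b : Set E))
  let Φ := Lp.compMeasurePreservingₗᵢ ℂ (E := ℂ) (p := 2) _ hν
  suffices h : (⊤ : Submodule ℂ (Lp ℂ 2 ν)) ≤ K.topologicalClosure.comap Φ.toLinearMap from
    h (Submodule.mem_top (x := g))
  rw [← topologicalClosure_span_mFourier_toLp]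
  refine Submodule.topologicalClosure_minimal _ (Submodule.span_le.2 ?_)
    (K.isClosed_topologicalClosure.preimage Φ.continuous)
  rintro _ ⟨n, rfl⟩
  refine K.le_topologicalClosure (Submodule.subset_span ⟨∑ i, n i • b i, ?_, ?_⟩)
  · exact sum_mem fun i _ => zsmul_mem (Submodule.subset_span (Set.mem_range_self i)) _
  · exact (compMeasurePreserving_mFourier b μ hν n).symm

theorem toLp_mem_closure_span_characterLp (b : Module.Basis (Fin d) ℝ E) (μ : Measure E)
    [IsFiniteMeasure μ] {q : E → ℂ} (hq : Measurable q)
    (hper : ∀ (k : lattice (scaledDualBasis b)) x, q (k +ᵥ x) = q x) (hL : MemLp q 2 μ) :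
    hL.toLp q ∈ (Submodule.span ℂ
      (characterLp μ '' (lattice b : Set E))).topologicalClosure := by
  set a := scaledDualBasis b
  have hν : MeasurePreserving (toTorus a) μ (μ.map (toTorus a)) :=
    (continuous_toTorus a).measurable.measurePreserving μ
  have hfract (x : E) : q (ZSpan.fract a x) = q x := by
    let k : lattice a := ZSpan.floor a x
    rw [← hper (-k) x, Submodule.vadd_def, vadd_eq_add, NegMemClass.coe_neg, neg_add_eq_sub]
    rfl
  have hfactor : (q ∘ ofTorus a) ∘ toTorus a = q :=
    funext fun x => by simp only [Function.comp_apply, ofTorus_toTorus, hfract]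
  have hgL : MemLp (q ∘ ofTorus a) 2 (μ.map (toTorus a)) := by
    rwa [memLp_map_measure_iff (hq.comp (measurable_ofTorus a)).aestronglyMeasurable
      hν.measurable.aemeasurable, hfactor]
  have hΦ : Lp.compMeasurePreserving _ hν (hgL.toLp _) = hL.toLp q := by
    rw [Lp.toLp_compMeasurePreserving hgL hν]
    simp only [hfactor]
  exact hΦ ▸ compMeasurePreserving_mem_closure_span_characterLp b μ hν _

end Density

section Gram

open Submodule

theorem norm_sub_starProjection_topologicalClosure {𝕜 H : Type*} [RCLike 𝕜]
    [NormedAddCommGroup H] [InnerProductSpace 𝕜 H] (K : Submodule 𝕜 H)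
    [CompleteSpace K.topologicalClosure] (u : H) :
    ‖u - K.topologicalClosure.starProjection u‖ = Metric.infDist u K := by
  rw [starProjection_minimal, ← Metric.infDist_closure, Metric.infDist_eq_iInf]
  simp only [dist_eq_norm]
  rfl

section StarAlgHom

variable {ι 𝕜 𝕜' H H' : Type*} [RCLike 𝕜] [RCLike 𝕜'] [NormedAddCommGroup H]
  [InnerProductSpace 𝕜 H] [NormedAddCommGroup H'] [InnerProductSpace 𝕜' H']
  {φ : 𝕜 →⋆ₐ[ℝ] 𝕜'} {x : ι → H} {y : ι → H'}

theorem inner_linearCombination_of_gram (h : ∀ s t, φ ⟪x s, x t⟫_𝕜 = ⟪y s, y t⟫_𝕜')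
    (c e : ι →₀ 𝕜) :
    ⟪Finsupp.linearCombination 𝕜' y (c.mapRange φ (map_zero φ)),
      Finsupp.linearCombination 𝕜' y (e.mapRange φ (map_zero φ))⟫_𝕜' =
      φ ⟪Finsupp.linearCombination 𝕜 x c, Finsupp.linearCombination 𝕜 x e⟫_𝕜 := by
  simp only [Finsupp.linearCombination_apply, Finsupp.sum_mapRange_index, zero_smul,
    implies_true]
  simp only [Finsupp.sum, sum_inner, inner_sum, inner_smul_left, inner_smul_right, map_sum,
    map_mul, h, starRingEnd_apply, map_star]

theorem norm_linearCombination_of_gram (h : ∀ s t, φ ⟪x s, x t⟫_𝕜 = ⟪y s, y t⟫_𝕜')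
    (c : ι →₀ 𝕜) :
    ‖Finsupp.linearCombination 𝕜' y (c.mapRange φ (map_zero φ))‖ =
      ‖Finsupp.linearCombination 𝕜 x c‖ := by
  have hsq := inner_linearCombination_of_gram h c c
  rw [inner_self_eq_norm_sq_to_K, inner_self_eq_norm_sq_to_K, ← RCLike.ofReal_pow,
    ← RCLike.ofReal_pow, ← RCLike.algebraMap_eq_ofReal, ← RCLike.algebraMap_eq_ofReal,
    AlgHomClass.commutes, RCLike.algebraMap_eq_ofReal] at hsq
  exact (sq_eq_sq₀ (norm_nonneg _) (norm_nonneg _)).1 (RCLike.ofReal_injective hsq)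

theorem norm_sub_linearCombination_of_gram (h : ∀ s t, φ ⟪x s, x t⟫_𝕜 = ⟪y s, y t⟫_𝕜')
    (t : ι) (c : ι →₀ 𝕜) :
    ‖y t - Finsupp.linearCombination 𝕜' y (c.mapRange φ (map_zero φ))‖ =
      ‖x t - Finsupp.linearCombination 𝕜 x c‖ := by
  have hn := norm_linearCombination_of_gram h (Finsupp.single t 1 - c)
  rw [Finsupp.mapRange_sub (map_sub φ), map_sub, map_sub] at hn
  simpa using hn

end StarAlgHom

/-- The canonical embedding of `ℝ` or `ℂ` into `ℂ`. -/
def toComplexStarAlgHom (𝕜 : Type*) [RCLike 𝕜] : 𝕜 →⋆ₐ[ℝ] ℂ where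
  toFun := RCLike.map 𝕜 ℂ
  map_one' := by simp
  map_mul' x y := by apply Complex.ext <;> simp [RCLike.mul_re, RCLike.mul_im]
  map_zero' := map_zero _
  map_add' := map_add _
  commutes' r := by simp
  map_star' x := by apply Complex.ext <;> simp

variable {ι 𝕜 H H' : Type*} [RCLike 𝕜] [NormedAddCommGroup H] [InnerProductSpace 𝕜 H]
  [NormedAddCommGroup H'] [InnerProductSpace ℂ H'] {x : ι → H} {y : ι → H'}

/-- `Re c` is the mean of `c` and its conjugate, whose combinations are equally far from `y t`. -/
theorem norm_sub_linearCombination_re_le (h : ∀ s t, (⟪y s, y t⟫_ℂ).im = 0) (t : ι)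
    (c : ι →₀ ℂ) :
    ‖y t - Finsupp.linearCombination ℂ y (c.mapRange (fun z => (z.re : ℂ)) (by simp))‖ ≤
      ‖y t - Finsupp.linearCombination ℂ y c‖ := by
  let φ : ℂ →⋆ₐ[ℝ] ℂ := { Complex.conjAe.toAlgHom with map_star' := fun _ => rfl }
  have hφ (z : ℂ) : φ z = starRingEnd ℂ z := rfl
  have hgram (s t : ι) : φ ⟪y s, y t⟫_ℂ = ⟪y s, y t⟫_ℂ := Complex.conj_eq_iff_im.2 (h s t)
  have hre : c.mapRange (fun z => (z.re : ℂ)) (by simp) =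
      (2⁻¹ : ℂ) • (c + c.mapRange φ (map_zero φ)) := by
    ext i
    simp [hφ, Complex.re_eq_add_conj, div_eq_inv_mul, mul_add]
  set u := y t - Finsupp.linearCombination ℂ y c
  set v := y t - Finsupp.linearCombination ℂ y (c.mapRange φ (map_zero φ))
  have hmean : y t - Finsupp.linearCombination ℂ y (c.mapRange (fun z => (z.re : ℂ)) (by simp)) =
      (2⁻¹ : ℂ) • (u + v) := by
    rw [hre, map_smul, map_add]
    module
  have hv : ‖v‖ = ‖u‖ := norm_sub_linearCombination_of_gram hgram t c
  calc _ = 2⁻¹ * ‖u + v‖ := by rw [hmean, norm_smul, norm_inv, Complex.norm_ofNat]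
    _ ≤ 2⁻¹ * (‖u‖ + ‖v‖) := by gcongr; exact norm_add_le u v
    _ = ‖u‖ := by rw [hv]; ring

theorem exists_norm_sub_linearCombination_le_of_gram
    (h : ∀ s t, RCLike.map 𝕜 ℂ ⟪x s, x t⟫_𝕜 = ⟪y s, y t⟫_ℂ) (t : ι) (c : ι →₀ ℂ) :
    ∃ e : ι →₀ 𝕜, e.support ⊆ c.support ∧
      ‖x t - Finsupp.linearCombination 𝕜 x e‖ ≤ ‖y t - Finsupp.linearCombination ℂ y c‖ := by
  refine ⟨c.mapRange (RCLike.map ℂ 𝕜) (map_zero _), Finsupp.support_mapRange, ?_⟩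
  rw [← norm_sub_linearCombination_of_gram (φ := toComplexStarAlgHom 𝕜) h]
  rcases RCLike.I_eq_zero_or_im_I_eq_one (K := 𝕜) with hI | hI
  · have hreal (s t : ι) : (⟪y s, y t⟫_ℂ).im = 0 := by
      simp [← h, RCLike.im_eq_zero hI]
    convert norm_sub_linearCombination_re_le hreal t c using 4
    ext i
    simp [toComplexStarAlgHom, hI]
  · refine le_of_eq ?_
    congr 3
    ext i
    apply Complex.ext <;> simp [toComplexStarAlgHom, hI]

theorem infDist_span_image_eq_of_gram
    (h : ∀ s t, RCLike.map 𝕜 ℂ ⟪x s, x t⟫_𝕜 = ⟪y s, y t⟫_ℂ) (T : Set ι) (t : ι) :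
    Metric.infDist (x t) (span 𝕜 (x '' T)) = Metric.infDist (y t) (span ℂ (y '' T)) := by
  refine le_antisymm ((Metric.le_infDist (Submodule.nonempty _)).2 fun v hv => ?_)
    ((Metric.le_infDist (Submodule.nonempty _)).2 fun v hv => ?_)
  · obtain ⟨c, hc, rfl⟩ := (Finsupp.mem_span_image_iff_linearCombination ℂ).1 hv
    obtain ⟨e, he, hle⟩ := exists_norm_sub_linearCombination_le_of_gram h t c
    refine (Metric.infDist_le_dist_of_mem
      ((Finsupp.mem_span_image_iff_linearCombination 𝕜).2 ⟨e, ?_, rfl⟩)).trans ?_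
    · exact (Finset.coe_subset.2 he).trans hc
    · simpa only [dist_eq_norm] using hle
  · obtain ⟨c, hc, rfl⟩ := (Finsupp.mem_span_image_iff_linearCombination 𝕜).1 hv
    rw [dist_eq_norm, ← norm_sub_linearCombination_of_gram (φ := toComplexStarAlgHom 𝕜) h,
      ← dist_eq_norm]
    exact Metric.infDist_le_dist_of_mem ((Finsupp.mem_span_image_iff_linearCombination ℂ).2
      ⟨_, (Finset.coe_subset.2 Finsupp.support_mapRange).trans hc, rfl⟩)

end Gram

section SpectralMeasure

variable {E : Type*} [NormedAddCommGroup E] [InnerProductSpace ℝ E] {S : E → ℝ}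

theorem norm_orbitAverage_character_le {L : Submodule ℤ E} (hS₀ : ∀ ω, 0 ≤ S ω) (t ω : E) :
    ‖orbitAverage L S (character t) ω‖ ≤ 1 :=
  norm_orbitAverage_le hS₀ (fun ω => (norm_character t ω).le) ω

/-- The share of the frequency `ω` that is lost when `X(t)` is interpolated from samples whose
spectrum `S` is aliased along `L`: the error variance at `t` has spectral density
`S ω * relativeError L S t ω`. -/
def relativeError (L : Submodule ℤ E) (S : E → ℝ) (t ω : E) : ℂ :=
  1 - starRingEnd ℂ (character t ω) * orbitAverage L S (character t) ω

theorem norm_relativeError_le {L : Submodule ℤ E} (hS₀ : ∀ ω, 0 ≤ S ω) (t ω : E) :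
    ‖relativeError L S t ω‖ ≤ 2 := by
  refine (norm_sub_le _ _).trans ?_
  rw [norm_mul, RCLike.norm_conj, norm_character, norm_one]
  linarith [norm_orbitAverage_character_le (L := L) hS₀ t ω]

variable [FiniteDimensional ℝ E] [MeasurableSpace E] [BorelSpace E]

/-- The spectral measure `(2π)⁻ᵈ S(ω) dω` of a process with power spectral density `S`; its total
mass is the process variance. -/
def spectralMeasure (S : E → ℝ) : Measure E :=
  volume.withDensity fun ω => ENNReal.ofReal (((2 * Real.pi) ^ Module.finrank ℝ E)⁻¹ * S ω)

theorem isFiniteMeasure_spectralMeasure (hS : Integrable S) :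
    IsFiniteMeasure (spectralMeasure S) :=
  isFiniteMeasure_withDensity_ofReal (hS.const_mul _).2

theorem integral_spectralMeasure (hS : Measurable S) (hS₀ : ∀ ω, 0 ≤ S ω) (f : E → ℂ) :
    ∫ ω, f ω ∂spectralMeasure S =
      ((2 * (Real.pi : ℂ)) ^ Module.finrank ℝ E)⁻¹ * ∫ ω, S ω * f ω := by
  rw [spectralMeasure, integral_withDensity_eq_integral_toReal_smul (by fun_prop) (by simp),
    ← integral_const_mul]
  refine integral_congr_ae (.of_forall fun ω => ?_)
  have hnonneg : 0 ≤ ((2 * Real.pi) ^ Module.finrank ℝ E)⁻¹ * S ω :=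
    mul_nonneg (by positivity) (hS₀ ω)
  simp only [ENNReal.toReal_ofReal hnonneg, Complex.real_smul]
  push_cast
  ring

theorem measurable_orbitAverage_character {L : Submodule ℤ E} [Countable L] (hS : Measurable S) :
    Measurable fun p : E × E => orbitAverage L S (character p.1) p.2 :=
  measurable_orbitAverage hS (by fun_prop : Continuous fun p : (E × E) × E =>
    character p.1.1 p.2).measurable measurable_snd

theorem memLp_orbitAverage_character {L : Submodule ℤ E} [Countable L] (hS : Measurable S)
    (hS₀ : ∀ ω, 0 ≤ S ω) (μ : Measure E) [IsFiniteMeasure μ] (t : E) :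
    MemLp (orbitAverage L S (character t)) 2 μ :=
  .of_bound
    ((measurable_orbitAverage_character hS).comp measurable_prodMk_left).aestronglyMeasurable 1
    (.of_forall (norm_orbitAverage_character_le hS₀ t))

theorem measurable_relativeError {L : Submodule ℤ E} [Countable L] (hS : Measurable S) :
    Measurable fun p : E × E => relativeError L S p.1 p.2 :=
  ((by fun_prop : Continuous fun p : E × E => starRingEnd ℂ (character p.1 p.2)).measurable.mul
    (measurable_orbitAverage_character hS)).const_sub 1

variable {d : ℕ} {b : Module.Basis (Fin d) ℝ E}

theorem integral_conj_character_mul_orbitAverage (hS : Measurable S) (hS₀ : ∀ ω, 0 ≤ S ω)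
    (hS_int : Integrable S) {s : E} (hs : s ∈ lattice b) (t : E) :
    ∫ ω, starRingEnd ℂ (character s ω) *
        orbitAverage (lattice (scaledDualBasis b)) S (character t) ω ∂spectralMeasure S =
      ∫ ω, starRingEnd ℂ (character s ω) * character t ω ∂spectralMeasure S := by
  have hperiodic (k : lattice (scaledDualBasis b)) (ω : E) :
      character s (k +ᵥ ω) = character s ω := by
    rw [Submodule.vadd_def, vadd_eq_add, character_add_right,
      character_eq_one hs (scaledDual_lattice b ▸ k.2), one_mul]
  have havg (ω : E) : starRingEnd ℂ (character s ω) *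
      orbitAverage (lattice (scaledDualBasis b)) S (character t) ω =
        orbitAverage (lattice (scaledDualBasis b)) S (character (t - s)) ω := by
    rw [mul_comm, ← orbitAverage_mul_of_invariant S (character t)
      (h := fun ω => starRingEnd ℂ (character s ω)) fun k ω => congrArg _ (hperiodic k ω)]
    simp only [mul_comm (character t _), conj_character_mul_character, sub_eq_add_neg]
  simp only [integral_spectralMeasure hS hS₀, havg, conj_character_mul_character]
  rw [integral_mul_orbitAverage (isAddFundamentalDomain_voronoiCell _) hS₀ hS hS_int
    (by fun_prop : Continuous _).measurable fun ω => (norm_character _ ω).le]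

theorem starProjection_characterLp [IsFiniteMeasure (spectralMeasure S)] (hS : Measurable S)
    (hS₀ : ∀ ω, 0 ≤ S ω) (hS_int : Integrable S) (t : E) :
    (Submodule.span ℂ (characterLp (spectralMeasure S) ''
        (lattice b : Set E))).topologicalClosure.starProjection
        (characterLp (spectralMeasure S) t) =
      (memLp_orbitAverage_character (L := lattice (scaledDualBasis b)) hS hS₀
        (spectralMeasure S) t).toLp _ := by
  refine Submodule.eq_starProjection_of_mem_orthogonal ?_ ?_
  · exact toLp_mem_closure_span_characterLp b _
      ((measurable_orbitAverage_character hS).comp measurable_prodMk_left)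
      (orbitAverage_vadd S (character t)) _
  · rw [Submodule.orthogonal_closure, Submodule.mem_orthogonal]
    refine fun v hv => Submodule.mem_orthogonal_singleton_iff_inner_left.1
      (Submodule.span_le.2 ?_ hv)
    rintro _ ⟨s, hs, rfl⟩
    refine Submodule.mem_orthogonal_singleton_iff_inner_left.2 ?_
    rw [inner_sub_right, inner_characterLp_toLp,
      integral_conj_character_mul_orbitAverage hS hS₀ hS_int hs, inner_characterLp, sub_eq_zero]
    simp only [conj_character_mul_character]

theorem norm_sub_starProjection_characterLp_sq [IsFiniteMeasure (spectralMeasure S)]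
    (hS : Measurable S) (hS₀ : ∀ ω, 0 ≤ S ω) (hS_int : Integrable S) (t : E) :
    ((‖characterLp (spectralMeasure S) t - (Submodule.span ℂ (characterLp (spectralMeasure S) ''
        (lattice b : Set E))).topologicalClosure.starProjection
        (characterLp (spectralMeasure S) t)‖ ^ 2 : ℝ) : ℂ) =
      ((2 * (Real.pi : ℂ)) ^ Module.finrank ℝ E)⁻¹ *
        ∫ ω, S ω * relativeError (lattice (scaledDualBasis b)) S t ω := by
  set K := (Submodule.span ℂ (characterLp (spectralMeasure S) ''
    (lattice b : Set E))).topologicalClosure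
  set u := characterLp (spectralMeasure S) t with hu
  have hq := memLp_orbitAverage_character (L := lattice (scaledDualBasis b)) hS hS₀
    (spectralMeasure S) t
  have horth : ⟪K.starProjection u, u - K.starProjection u⟫_ℂ = 0 :=
    K.sub_starProjection_mem_orthogonal u _ (K.starProjection_apply_mem u)
  calc _ = ⟪u - K.starProjection u, u - K.starProjection u⟫_ℂ := by
        rw [inner_self_eq_norm_sq_to_K, Complex.ofReal_pow]
        rfl
    _ = ⟪u, u - K.starProjection u⟫_ℂ := by rw [inner_sub_left, horth, sub_zero]
    _ = ∫ ω, starRingEnd ℂ (character t ω) * (character t ω -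
          orbitAverage (lattice (scaledDualBasis b)) S (character t) ω) ∂spectralMeasure S := by
        rw [starProjection_characterLp hS hS₀ hS_int, hu]
        exact inner_characterLp_toLp _ t ((memLp_character _ t).sub hq)
    _ = _ := by
        simp only [integral_spectralMeasure hS hS₀, relativeError, mul_sub,
          conj_character_mul_character, sub_self, character_zero_left]

end SpectralMeasure

section Stationary

variable {E : Type*} [NormedAddCommGroup E] {Ω : Type*} [MeasurableSpace Ω] {P : Measure Ω}
  {𝕜 : Type*} [RCLike 𝕜] {X : E → Ω → 𝕜}

theorem inner_toLp_eq_autocorr (hX : IsStationary P X) (s t : E) :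
    ⟪(hX.memLp s).toLp (X s), (hX.memLp t).toLp (X t)⟫_𝕜 = autocorr P X t s := by
  rw [L2.inner_def, autocorr]
  refine integral_congr_ae ?_
  filter_upwards [(hX.memLp s).coeFn_toLp, (hX.memLp t).coeFn_toLp] with w hs ht
  rw [hs, ht, RCLike.inner_apply]

theorem errorVarianceAt_eq_norm_sq (hX : IsStationary P X) (L : Submodule ℤ E) (t : E) :
    errorVarianceAt hX L t =
      ‖(hX.memLp t).toLp (X t) - bestLinearInterpolator hX L t‖ ^ 2 := by
  rw [← @inner_self_eq_norm_sq 𝕜, L2.inner_def, ← integral_re (L2.integrable_inner _ _),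
    errorVarianceAt]
  refine integral_congr_ae ?_
  filter_upwards [(hX.memLp t).coeFn_toLp,
    Lp.coeFn_sub ((hX.memLp t).toLp (X t)) (bestLinearInterpolator hX L t)] with w ht hsub
  rw [hsub, inner_self_eq_norm_sq, Pi.sub_apply, ht]

end Stationary

section ErrorVariance

variable {E : Type*} [NormedAddCommGroup E] [InnerProductSpace ℝ E]

theorem conj_character_mul_orbitAverage (M : Submodule ℤ E) (S : E → ℝ) (t ω : E) :
    starRingEnd ℂ (character t ω) * orbitAverage M S (character t) ω =
      (∑' k : M, S (k + ω) * character t k) / orbitSum M S ω := by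
  rw [orbitAverage, orbitSum, mul_div_assoc', ← tsum_mul_left]
  congr! 3 with k
  have hunit : starRingEnd ℂ (character t ω) * character t ω = 1 := by
    rw [conj_character_mul_character, sub_self, character_zero_left]
  rw [Submodule.vadd_def, vadd_eq_add, character_add_right]
  linear_combination (S (k + ω) * character t k : ℂ) * hunit

variable [FiniteDimensional ℝ E] [MeasurableSpace E] [BorelSpace E]

/-- Only the term `k = 0` of the orbit sum survives, by orthogonality of the characters on `V`. -/
theorem setIntegral_conj_character_mul_orbitAverage {L M : Submodule ℤ E} [Countable L]
    [Countable M] (hM : (M : Set E) ⊆ scaledDual L) {V : Set E}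
    (hV : IsAddFundamentalDomain L V (volume : Measure E)) (hV_fin : volume V ≠ ⊤) (S : E → ℝ)
    (ω : E) :
    ∫ t in V, starRingEnd ℂ (character t ω) * orbitAverage M S (character t) ω =
      volume.real V * (S ω / orbitSum M S ω) := by
  simp only [conj_character_mul_orbitAverage, integral_div]
  by_cases hs : Summable fun k : M => S (k + ω)
  · have hint (k : M) : IntegrableOn (fun t : E => (S (k + ω) : ℂ) * character t k) V :=
      (Measure.integrableOn_of_bounded hV_fin
        (by fun_prop : Continuous fun t : E => character t k).aestronglyMeasurable
        (.of_forall fun t => (norm_character t k).le)).const_mul _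
    have hsum : Summable fun k : M => ∫ t : E in V, ‖(S (k + ω) : ℂ) * character t k‖ := by
      simpa [norm_character] using hs.norm.mul_left (volume.real V)
    have hterm (k : M) (hk : k ≠ 0) : ∫ t : E in V, (S (k + ω) : ℂ) * character t k = 0 := by
      rw [integral_const_mul, setIntegral_character_eq_zero hV (hM k.2) (by simpa using hk),
        mul_zero]
    rw [← integral_tsum_of_summable_integral_norm hint hsum, tsum_eq_single 0 hterm]
    simp only [ZeroMemClass.coe_zero, character_zero_right, zero_add, mul_one, setIntegral_const,
      Complex.real_smul, mul_div_assoc]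
  · have hzero : orbitSum M S ω = 0 := tsum_eq_zero_of_not_summable hs
    simp [hzero]

theorem setIntegral_relativeError {L M : Submodule ℤ E} [Countable L] [Countable M]
    (hM : (M : Set E) ⊆ scaledDual L) {V : Set E}
    (hV : IsAddFundamentalDomain L V (volume : Measure E)) (hV_fin : volume V ≠ ⊤) {S : E → ℝ}
    (hS_meas : Measurable S) (hS₀ : ∀ ω, 0 ≤ S ω) (ω : E) :
    ∫ t in V, relativeError M S t ω = volume.real V * (1 - S ω / orbitSum M S ω) := by
  have : IsFiniteMeasure (volume.restrict V) := isFiniteMeasure_restrict.2 hV_fin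
  have havg : Measurable fun t : E => orbitAverage M S (character t) ω :=
    (measurable_orbitAverage_character hS_meas).of_uncurry_right
  have hconj : Measurable fun t : E => starRingEnd ℂ (character t ω) :=
    (by fun_prop : Continuous fun t : E => starRingEnd ℂ (character t ω)).measurable
  have hint : IntegrableOn
      (fun t : E => starRingEnd ℂ (character t ω) * orbitAverage M S (character t) ω) V := by
    refine Integrable.of_bound (hconj.mul havg).aestronglyMeasurable 1 (.of_forall fun t => ?_)
    rw [norm_mul, RCLike.norm_conj, norm_character, one_mul]
    exact norm_orbitAverage_character_le hS₀ t ω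
  simp only [relativeError]
  rw [integral_sub (integrable_const 1) hint, setIntegral_const,
    setIntegral_conj_character_mul_orbitAverage hM hV hV_fin, Complex.real_smul, mul_sub]

variable {Ω : Type*} [MeasurableSpace Ω] {P : Measure Ω} {𝕜 : Type*} [RCLike 𝕜]
  {X : E → Ω → 𝕜} {S : E → ℝ}

theorem map_inner_toLp_eq_inner_characterLp [IsFiniteMeasure (spectralMeasure S)]
    (hX : IsStationary P X) (hS : HasSpectralDensity P X S) (hS_meas : Measurable S) (s t : E) :
    RCLike.map 𝕜 ℂ ⟪(hX.memLp s).toLp (X s), (hX.memLp t).toLp (X t)⟫_𝕜 =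
      ⟪characterLp (spectralMeasure S) s, characterLp (spectralMeasure S) t⟫_ℂ := by
  have hcorr := hS.autocorr_eq (t - s) s
  rw [add_sub_cancel] at hcorr
  rw [inner_toLp_eq_autocorr hX, hcorr, inner_characterLp,
    integral_spectralMeasure hS_meas hS.nonneg]
  rfl

theorem ofReal_errorVarianceAt {d : ℕ} (b : Module.Basis (Fin d) ℝ E) (hX : IsStationary P X)
    (hS : HasSpectralDensity P X S) (hS_meas : Measurable S) (t : E) :
    (errorVarianceAt hX (lattice b) t : ℂ) =
      ((2 * (Real.pi : ℂ)) ^ Module.finrank ℝ E)⁻¹ *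
        ∫ ω, S ω * relativeError (lattice (scaledDualBasis b)) S t ω := by
  have := isFiniteMeasure_spectralMeasure hS.integrable
  have hgram := map_inner_toLp_eq_inner_characterLp hX hS hS_meas
  have hdist := infDist_span_image_eq_of_gram hgram (lattice b : Set E) t
  rw [← norm_sub_starProjection_characterLp_sq hS_meas hS.nonneg hS.integrable,
    norm_sub_starProjection_topologicalClosure, ← hdist,
    ← norm_sub_starProjection_topologicalClosure, errorVarianceAt_eq_norm_sq]
  rfl

theorem integrable_mul_relativeError (M : Submodule ℤ E) [Countable M] (hS_meas : Measurable S)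
    (hS₀ : ∀ ω, 0 ≤ S ω) (hS : Integrable S) {V : Set E} (hV : volume V ≠ ⊤) :
    Integrable (fun p : E × E => (S p.2 : ℂ) * relativeError M S p.1 p.2)
      ((volume.restrict V).prod volume) := by
  have : IsFiniteMeasure (volume.restrict V) := isFiniteMeasure_restrict.2 hV
  have hS_snd : Integrable (fun p : E × E => (S p.2 : ℂ)) ((volume.restrict V).prod volume) :=
    (hS.ofReal (𝕜 := ℂ)).comp_snd (volume.restrict V)
  exact hS_snd.mul_bdd (measurable_relativeError hS_meas).aestronglyMeasurable
    (.of_forall fun p => norm_relativeError_le hS₀ p.1 p.2)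

theorem integrableOn_errorVarianceAt {d : ℕ} (b : Module.Basis (Fin d) ℝ E)
    (hX : IsStationary P X) (hS : HasSpectralDensity P X S) (hS_meas : Measurable S) {V : Set E}
    (hV : volume V ≠ ⊤) : IntegrableOn (errorVarianceAt hX (lattice b)) V := by
  have hint := (integrable_mul_relativeError (lattice (scaledDualBasis b)) hS_meas hS.nonneg
    hS.integrable hV).integral_prod_left.const_mul ((2 * (Real.pi : ℂ)) ^ Module.finrank ℝ E)⁻¹
  simp only [← ofReal_errorVarianceAt b hX hS hS_meas] at hint
  exact hint.re

theorem averageErrorVariance_eq {d : ℕ} (b : Module.Basis (Fin d) ℝ E)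
    (hX : IsStationary P X) (hS : HasSpectralDensity P X S) (hS_meas : Measurable S) :
    averageErrorVariance hX (lattice b) = ((2 * Real.pi) ^ Module.finrank ℝ E)⁻¹ *
      ∫ ω, S ω * (1 - S ω / orbitSum (lattice (scaledDualBasis b)) S ω) := by
  let V := voronoiCell (lattice b)
  let M := lattice (scaledDualBasis b)
  have hV₀ : 0 < volume.real V := volume_real_voronoiCell_pos (lattice b)
  have hV_fin : volume V ≠ ⊤ := volume_voronoiCell_ne_top _
  have hinner (ω : E) : ∫ t in V, S ω * relativeError M S t ω =
      volume.real V * (S ω * (1 - S ω / orbitSum M S ω) : ℝ) := by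
    rw [integral_const_mul, setIntegral_relativeError (scaledDual_lattice b).ge
      (isAddFundamentalDomain_voronoiCell _) hV_fin hS_meas hS.nonneg]
    push_cast
    ring
  have htotal : ((∫ t in V, errorVarianceAt hX (lattice b) t : ℝ) : ℂ) =
      ((2 * (Real.pi : ℂ)) ^ Module.finrank ℝ E)⁻¹ *
        (volume.real V * ∫ ω, ((S ω * (1 - S ω / orbitSum M S ω) : ℝ) : ℂ)) :=
    calc _ = ((2 * (Real.pi : ℂ)) ^ Module.finrank ℝ E)⁻¹ *
          ∫ t in V, ∫ ω, S ω * relativeError M S t ω := by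
          rw [← integral_complex_ofReal, ← integral_const_mul]
          simp only [ofReal_errorVarianceAt b hX hS hS_meas, M]
      _ = _ := by
          rw [integral_integral_swap (f := fun t ω => S ω * relativeError M S t ω)
            (integrable_mul_relativeError M hS_meas hS.nonneg hS.integrable hV_fin)]
          simp only [hinner, integral_const_mul]
  rw [averageErrorVariance, setAverage_eq, smul_eq_mul, inv_mul_eq_iff_eq_mul₀ hV₀.ne']
  apply Complex.ofReal_injective
  rw [htotal, integral_complex_ofReal]
  push_cast
  ring

end ErrorVariance

section FlatSpectrum

variable {G α : Type*} [AddGroup G] [AddAction G α]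

theorem le_orbitSum {ρ : α → ℝ} (hρ : ∀ x, 0 ≤ ρ x) {x : α}
    (hs : Summable fun g : G => ρ (g +ᵥ x)) : ρ x ≤ orbitSum G ρ x :=
  calc ρ x = ρ ((0 : G) +ᵥ x) := by rw [zero_vadd]
    _ ≤ orbitSum G ρ x := hs.le_tsum 0 fun g _ => hρ (g +ᵥ x)

theorem norm_div_orbitSum_le_one {ρ : α → ℝ} (hρ : ∀ x, 0 ≤ ρ x) (x : α) :
    ‖ρ x / orbitSum G ρ x‖ ≤ 1 := by
  by_cases hs : Summable fun g : G => ρ (g +ᵥ x)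
  · have hle : ρ x ≤ orbitSum G ρ x := le_orbitSum hρ hs
    rw [Real.norm_of_nonneg (div_nonneg (hρ x) ((hρ x).trans hle))]
    exact div_le_one_of_le₀ hle ((hρ x).trans hle)
  · rw [orbitSum, tsum_eq_zero_of_not_summable hs, div_zero, norm_zero]
    exact zero_le_one

theorem orbitSum_mul_div_orbitSum_indicator {Δ V : Set α}
    (hΔ : ∀ g : G, ∀ x ∈ V, g +ᵥ x ∈ Δ → x ∈ Δ) {c : ℝ} (hc : 0 ≤ c) {x : α} (hx : x ∈ V)
    (hs : Summable fun g : G => Δ.indicator (fun _ => c) (g +ᵥ x)) :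
    orbitSum G (Δ.indicator fun _ => c) x * (c / orbitSum G (Δ.indicator fun _ => c) x) =
      Δ.indicator (fun _ => c) x := by
  by_cases hxΔ : x ∈ Δ
  · have hle : c ≤ orbitSum G (Δ.indicator fun _ => c) x := by
      simpa only [Set.indicator_of_mem hxΔ] using
        le_orbitSum (Set.indicator_nonneg fun _ _ => hc) hs
    rw [Set.indicator_of_mem hxΔ]
    rcases hc.eq_or_lt with rfl | hc
    · simp
    · exact mul_div_cancel₀ _ (hc.trans_le hle).ne'
  · have hzero (g : G) : Δ.indicator (fun _ => c) (g +ᵥ x) = 0 :=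
      Set.indicator_of_notMem (fun hg => hxΔ (hΔ g x hx hg)) _
    simp [orbitSum, hzero, hxΔ]

variable [Countable G] [MeasurableSpace α] [MeasurableConstVAdd G α] {μ : Measure α}

theorem integrable_mul_div_orbitSum {ρ : α → ℝ} (hρ : ∀ x, 0 ≤ ρ x) (hρ_meas : Measurable ρ)
    (hρ_int : Integrable ρ μ) : Integrable (fun x => ρ x * (ρ x / orbitSum G ρ x)) μ := by
  have hsum : Measurable (orbitSum G ρ) := (stronglyMeasurable_orbitSum
    (hρ_meas.comp measurable_snd).stronglyMeasurable measurable_id).measurable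
  exact hρ_int.mul_bdd (hρ_meas.div hsum).aestronglyMeasurable
    (.of_forall (norm_div_orbitSum_le_one hρ))

variable [VAddInvariantMeasure G α μ] {V Δ : Set α}

theorem integral_indicator_mul_div_orbitSum (hV : IsAddFundamentalDomain G V μ)
    (hΔ_meas : MeasurableSet Δ) (hΔ_fin : μ Δ ≠ ⊤)
    (hΔ : ∀ g : G, ∀ x ∈ V, g +ᵥ x ∈ Δ → x ∈ Δ) {c : ℝ} (hc : 0 ≤ c) :
    ∫ x, Δ.indicator (fun _ => c) x *
        (Δ.indicator (fun _ => c) x / orbitSum G (Δ.indicator fun _ => c) x) ∂μ =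
      μ.real (Δ ∩ V) * c := by
  set ρ : α → ℝ := Δ.indicator fun _ => c with hρ_def
  have hρ : ∀ x, 0 ≤ ρ x := Set.indicator_nonneg fun _ _ => hc
  have hρ_meas : Measurable ρ := measurable_const.indicator hΔ_meas
  have hρ_int : Integrable ρ μ := (integrableOn_const hΔ_fin).integrable_indicator hΔ_meas
  have hsq (x : α) : ρ x * (ρ x / orbitSum G ρ x) = ρ x * (c / orbitSum G ρ x) := by
    by_cases hx : x ∈ Δ <;> simp [hρ_def, hx]
  have hinv (g : G) (x : α) : c / orbitSum G ρ (g +ᵥ x) = c / orbitSum G ρ x := by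
    rw [orbitSum_vadd]
  have hint := integrable_mul_div_orbitSum (G := G) hρ hρ_meas hρ_int
  simp only [hsq] at hint ⊢
  calc ∫ x, ρ x * (c / orbitSum G ρ x) ∂μ
      = ∫ x in V, orbitSum G ρ x * (c / orbitSum G ρ x) ∂μ := by
        rw [← setIntegral_orbitSum hV hint]
        simp only [orbitSum_mul_of_invariant ρ (h := fun x => c / orbitSum G ρ x) hinv]
    _ = ∫ x in V, ρ x ∂μ := by
        refine integral_congr_ae ?_
        filter_upwards [ae_summable_norm_vadd hV hρ_int, ae_restrict_mem₀ hV.nullMeasurableSet]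
          with x hs hx
        exact orbitSum_mul_div_orbitSum_indicator hΔ hc hx hs.of_norm
    _ = μ.real (Δ ∩ V) * c := by
        rw [integral_indicator_const c hΔ_meas, measureReal_restrict_apply hΔ_meas, smul_eq_mul]

theorem integral_indicator_mul_one_sub_div_orbitSum (hV : IsAddFundamentalDomain G V μ)
    (hΔ_meas : MeasurableSet Δ) (hΔ_fin : μ Δ ≠ ⊤)
    (hΔ : ∀ g : G, ∀ x ∈ V, g +ᵥ x ∈ Δ → x ∈ Δ) {c : ℝ} (hc : 0 ≤ c) :
    ∫ x, Δ.indicator (fun _ => c) x *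
        (1 - Δ.indicator (fun _ => c) x / orbitSum G (Δ.indicator fun _ => c) x) ∂μ =
      μ.real (Δ \ V) * c := by
  have hρ_int : Integrable (Δ.indicator fun _ => c) μ :=
    (integrableOn_const hΔ_fin).integrable_indicator hΔ_meas
  have hint := integrable_mul_div_orbitSum (G := G) (Set.indicator_nonneg fun _ _ => hc)
    (measurable_const.indicator hΔ_meas) hρ_int
  have hsplit : μ.real (Δ ∩ V) + μ.real (Δ \ V) = μ.real Δ :=
    measureReal_inter_add_sdiff₀ hV.nullMeasurableSet hΔ_fin
  simp only [mul_sub, mul_one]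
  rw [integral_sub hρ_int hint, integral_indicator_mul_div_orbitSum hV hΔ_meas hΔ_fin hΔ hc,
    integral_indicator_const c hΔ_meas, smul_eq_mul, ← hsplit]
  ring

end FlatSpectrum

end LatticeSampling

end

theorem theorem1_general {d : ℕ}
    {E : Type*} [NormedAddCommGroup E] [InnerProductSpace ℝ E] [FiniteDimensional ℝ E]
    [MeasurableSpace E] [BorelSpace E]
    {Ω : Type*} [MeasurableSpace Ω] (P : Measure Ω)
    {𝕜 : Type*} [RCLike 𝕜]
    (B : Module.Basis (Fin d) ℝ E) (A : Fin d → E)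
    (hA : (LatticeSampling.lattice A : Set E) =
      LatticeSampling.scaledDual (LatticeSampling.lattice B))
    (S₀ : ℝ) (Δ : Set E) (hΔ : MeasurableSet Δ) (hΔ₀ : volume Δ ≠ 0) (hΔ_fin : volume Δ ≠ ⊤)
    (hΔA : ∀ k ∈ LatticeSampling.lattice A,
      ∀ x ∈ LatticeSampling.voronoiCell (LatticeSampling.lattice A), k + x ∈ Δ → x ∈ Δ)
    (X : E → Ω → 𝕜) (hX : LatticeSampling.IsStationary P X)
    (hS : LatticeSampling.HasSpectralDensity P X (Δ.indicator fun _ => S₀)) :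
    IntegrableOn (LatticeSampling.errorVarianceAt hX (LatticeSampling.lattice B))
        (LatticeSampling.voronoiCell (LatticeSampling.lattice B)) ∧
      LatticeSampling.averageErrorVariance hX (LatticeSampling.lattice B) =
        LatticeSampling.processVariance (Δ.indicator fun _ => S₀) *
          (volume.real (Δ \ LatticeSampling.voronoiCell (LatticeSampling.lattice A)) /
            volume.real Δ) := by
  have hAB : LatticeSampling.lattice A =
      LatticeSampling.lattice (LatticeSampling.scaledDualBasis B) :=
    SetLike.coe_injective (hA.trans (LatticeSampling.scaledDual_lattice B))
  have hS_meas : Measurable (Δ.indicator fun _ => S₀) := measurable_const.indicator hΔ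
  have hS₀ : 0 ≤ S₀ := by
    obtain ⟨x, hx⟩ := nonempty_of_measure_ne_zero hΔ₀
    simpa only [Set.indicator_of_mem hx] using hS.nonneg x
  refine ⟨LatticeSampling.integrableOn_errorVarianceAt B hX hS hS_meas
    (LatticeSampling.volume_voronoiCell_ne_top _), ?_⟩
  rw [hAB] at hΔA ⊢
  rw [LatticeSampling.averageErrorVariance_eq B hX hS hS_meas,
    LatticeSampling.integral_indicator_mul_one_sub_div_orbitSum
      (G := LatticeSampling.lattice (LatticeSampling.scaledDualBasis B))
      (LatticeSampling.isAddFundamentalDomain_voronoiCell _) hΔ hΔ_fin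
      (fun k => hΔA k k.2) hS₀,
    LatticeSampling.processVariance, integral_indicator_const S₀ hΔ, smul_eq_mul]
  have hΔ_pos : volume.real Δ ≠ 0 := (ENNReal.toReal_pos hΔ₀ hΔ_fin).ne'
  field_simp

theorem theorem1 {d : ℕ}
    {E : Type*} [NormedAddCommGroup E] [InnerProductSpace ℝ E] [FiniteDimensional ℝ E]
    [MeasurableSpace E] [BorelSpace E]
    {Ω : Type*} [MeasurableSpace Ω] (P : Measure Ω) [IsProbabilityMeasure P]
    {𝕜 : Type*} [RCLike 𝕜]
    (B : Module.Basis (Fin d) ℝ E) (A : Fin d → E)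
    (hA : (LatticeSampling.lattice A : Set E) =
      LatticeSampling.scaledDual (LatticeSampling.lattice B))
    (S₀ ω₀ : ℝ) (hS₀ : 0 ≤ S₀) (hω₀ : 0 < ω₀)
    (X : E → Ω → 𝕜) (hX : LatticeSampling.IsStationary P X)
    (hS : LatticeSampling.HasSpectralDensity P X (LatticeSampling.flatSpectrum S₀ ω₀)) :
    IntegrableOn (LatticeSampling.errorVarianceAt hX (LatticeSampling.lattice B))
        (LatticeSampling.voronoiCell (LatticeSampling.lattice B)) ∧
      LatticeSampling.averageErrorVariance hX (LatticeSampling.lattice B) =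
        LatticeSampling.processVariance (LatticeSampling.flatSpectrum (E := E) S₀ ω₀) *
          (volume.real (Metric.closedBall (0 : E) ω₀ \
              LatticeSampling.voronoiCell (LatticeSampling.lattice A)) /
            volume.real (Metric.closedBall (0 : E) ω₀)) :=
  theorem1_general P B A hA S₀ _ measurableSet_closedBall
    (Metric.measure_closedBall_pos _ _ hω₀).ne' measure_closedBall_lt_top.ne
    (fun _ hk _ hx hkx => mem_closedBall_zero_iff.2 <|
      (LatticeSampling.norm_le_norm_add_of_mem_voronoiCell hk hx).trans
        (mem_closedBall_zero_iff.1 hkx)) X hX hS
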